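/- Let $S$ and $T$ be sets. The modified rainbow algebra $\mathcal B_{S,T}$ is defined as follows. Its atoms are $1'$, $\mathbf b$, $\mathbf w$, $\mathbf y$, the green atoms $\mathbf g_i$ ($i\in S$) and the red atoms $\mathbf r_{j,j'}$ ($j,j'\in T$). The only atom below the identity is $1'$. All atoms are self-converse, except that $\mathbf r_{j,j'}^{\smile}=\mathbf r_{j',j}$. The forbidden triples of atoms are the Peircean transforms $$(a,b,c),\ (a^\smile,c,b),\ (c,b^\smile,a),\ (b,c^\smile,a^\smile),\ (c^\smile,a,b^\smile),\ (b^\smile,a^\smile,c^\smile)$$ of the following triples $(a,b,c)$: 1. $(1',a,b)$ with $a\neq b$; 2. $(\mathbf g_i,\mathbf g_{i'},\mathbf g_{i''})$ and $(\mathbf g_i,\mathbf g_{i'},\mathbf w)$, for $i,i',i''\in S$; 3. $(\mathbf y,\mathbf y,\mathbf y)$ and $(\mathbf y,\mathbf y,\mathbf b)$; 4. $(\mathbf r_{j_1,j_2},\mathbf r_{k_2,k_3},\mathbf r_{l_1,l_3})$, unless $j_1=l_1$, $j_2=k_2$ and $k_3=l_3$; 5. $(\mathbf g_i,\mathbf g_i,\mathbf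 r_{j,j'})$ and $(\mathbf g_i,\mathbf g_{i'},\mathbf r_{j,j})$, for $i,i'\in S$ and $j,j'\in T$. $\mathcal B_{S,T}$ is the complex algebra of this atom structure: its elements are all sets of atoms, with the Boolean set operations, the identity element $\{1'\}$, the converse $P^\smile=\{a^\smile: a\in P\}$ and the composition $P;Q=\{c:\ (a,b,c)\text{ is not forbidden for some }a\in P,\ b\in Q\}$. For an equivalence relation $E$ on a set $X$, the proper relation algebra $\mathcal P(E)$ consists of all subsets of $E$, with the Boolean set operations (complement relative to $E$), the identity $\{(x,x):x\in X\}$, and the usual converse and composition of binary relations. An algebra of this similarity type is representable if it embeds into $\mathcal P(E)$ for some equivalence relation $E$, that is, if there is an injective map into $\mathcal P(E)$ that preserves all the operations. **Theorem 3.2.** Let $S,T$ be finite sets with $|S|\ge 2$. Then $\mathcal B_{S,T}$ is representable if and only if $|S|\le|T|$. -/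

import Mathlib

universe u v w

/-- Algebras of the similarity type of relation algebras: a Boolean algebra together with a constant
`ident` (the identity `1'`), a unary operation `conv` (converse) and a binary operation `comp`
(composition `;`). -/
class RelationTypeAlgebra (A : Type*) extends BooleanAlgebra A where
  /-- the identity `1'` -/
  ident : A
  /-- converse -/
  conv : A → A
  /-- composition -/
  comp : A → A → A

/-- The set of subsets of an equivalence relation `E` on a base `X`, `E` being viewed as a set of
pairs. -/
def ProperAlgebra {X : Type*} (E : Setoid X) : Type _ :=
  Set.Iic {p : X × X | E p.1 p.2}

/-- The Boolean algebra of all subsets of `E`: order, `∪`, `∩`, `∅` and `E` are the evident ones, and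
the complement of `R` is `E \ R`. -/
instance {X : Type*} (E : Setoid X) : BooleanAlgebra (ProperAlgebra E) where
  __ := (inferInstance : Lattice (Set.Iic {p : X × X | E p.1 p.2}))
  __ := (inferInstance : BoundedOrder (Set.Iic {p : X × X | E p.1 p.2}))
  compl R := ⟨{p : X × X | E p.1 p.2} \ R.1, fun _ hp => hp.1⟩
  le_sup_inf R R' R'' := by
    rintro p ⟨h1 | h1, h2 | h2⟩
    · exact Or.inl h1
    · exact Or.inl h1
    · exact Or.inl h2
    · exact Or.inr ⟨h1, h2⟩
  inf_compl_le_bot R := fun _ hp => hp.2.2 hp.1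
  top_le_sup_compl R := fun p hp => by
    by_cases h : p ∈ R.1
    · exact Or.inl h
    · exact Or.inr ⟨hp, h⟩

/-- The proper relation algebra `𝒫(E)` of all subsets of an equivalence relation `E` on `X`, with the
diagonal of `X`, the converse of binary relations and the composition of binary relations. -/
instance {X : Type*} (E : Setoid X) : RelationTypeAlgebra (ProperAlgebra E) where
  ident := ⟨{p : X × X | p.1 = p.2}, by
    rintro ⟨x, y⟩ (rfl : x = y)
    exact E.refl x⟩
  conv R := ⟨{p : X × X | (p.2, p.1) ∈ R.1}, fun _ hp => E.symm (R.2 hp)⟩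
  comp R R' := ⟨{p : X × X | ∃ z, (p.1, z) ∈ R.1 ∧ (z, p.2) ∈ R'.1}, by
    rintro p ⟨z, h1, h2⟩
    have e1 : E p.1 z := R.2 h1
    have e2 : E z p.2 := R'.2 h2
    exact E.trans e1 e2⟩

/-- A representation of `A` on the equivalence relation `E`: an embedding of `A` into the proper
relation algebra `𝒫(E)`, that is, an injective map that preserves all the operations. -/
structure RelationRepresentation (A : Type*) [RelationTypeAlgebra A] {X : Type*} (E : Setoid X) where
  /-- the underlying map -/
  toFun : A → ProperAlgebra E
  injective : Function.Injective toFun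
  map_bot : toFun ⊥ = ⊥
  map_top : toFun ⊤ = ⊤
  map_sup : ∀ a b, toFun (a ⊔ b) = toFun a ⊔ toFun b
  map_compl : ∀ a, toFun aᶜ = (toFun a)ᶜ
  map_ident : toFun RelationTypeAlgebra.ident = RelationTypeAlgebra.ident
  map_conv : ∀ a, toFun (RelationTypeAlgebra.conv a) = RelationTypeAlgebra.conv (toFun a)
  map_comp : ∀ a b, toFun (RelationTypeAlgebra.comp a b) =
    RelationTypeAlgebra.comp (toFun a) (toFun b)

/-- `A` is representable, with a base in the universe `w`. (The relation algebra axioms are equations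
that hold in all proper relation algebras, so they hold in every representable `A`.) -/
def Representable (A : Type u) [RelationTypeAlgebra A] : Prop :=
  ∃ (X : Type w) (E : Setoid X), Nonempty (RelationRepresentation A E)

/-- An atom structure on the set `α` of atoms: the atoms below the identity, the converses of the
atoms, and the consistent triples `(a, b, c)`, those with `a ; b ≥ c`. -/
structure AtomStructure (α : Type*) where
  /-- the atoms below `1'` -/
  ident : Set α
  /-- the converse of an atom -/
  conv : α → α
  /-- the consistent triples -/
  consistent : α → α → α → Prop

/-- The elements of the complex algebra of an atom structure: arbitrary sets of atoms. -/
def ComplexAlgebra {α : Type*} (_𝔸 : AtomStructure α) : Type _ := Set α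

instance {α : Type*} (𝔸 : AtomStructure α) : BooleanAlgebra (ComplexAlgebra 𝔸) :=
  inferInstanceAs (BooleanAlgebra (Set α))

/-- The complex algebra of an atom structure: the Boolean algebra of all sets of atoms, with the
operations that extend the atom structure completely additively. -/
instance {α : Type*} (𝔸 : AtomStructure α) : RelationTypeAlgebra (ComplexAlgebra 𝔸) where
  ident := 𝔸.ident
  conv P := {a : α | ∃ b : α, b ∈ (show Set α from P) ∧ 𝔸.conv b = a}
  comp P Q := {c : α | ∃ a b : α,
    a ∈ (show Set α from P) ∧ b ∈ (show Set α from Q) ∧ 𝔸.consistent a b c}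

/-- The six Peircean transforms of a triple `(a, b, c)` of atoms, for the converse map `conv`. -/
def peirceanTransforms {α : Type*} (conv : α → α) (a b c : α) : Set (α × α × α) :=
  {(a, b, c), (conv a, c, b), (c, conv b, a), (b, conv c, conv a), (conv c, a, conv b),
    (conv b, conv a, conv c)}

/-- The atoms of the modified rainbow algebra: the identity, one black, one white and one yellow
atom, green atoms indexed by `S` and red atoms indexed by `T × T`. -/
inductive RainbowAtom (S T : Type*) where
  | one : RainbowAtom S T
  | black : RainbowAtom S T
  | white : RainbowAtom S T
  | yellow : RainbowAtom S T
  | green (i : S) : RainbowAtom S T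
  | red (j j' : T) : RainbowAtom S T

namespace RainbowAtom

/-- All atoms are self-converse, except that the converse of `red j j'` is `red j' j`. -/
def conv {S T : Type*} : RainbowAtom S T → RainbowAtom S T
  | red j j' => red j' j
  | a => a

/-- The triples of atoms whose Peircean transforms are forbidden. -/
inductive BaseForbidden {S T : Type*} :
    RainbowAtom S T → RainbowAtom S T → RainbowAtom S T → Prop
  | one (a b : RainbowAtom S T) : a ≠ b → BaseForbidden one a b
  | green_green_green (i i' i'' : S) : BaseForbidden (green i) (green i') (green i'')
  | green_green_white (i i' : S) : BaseForbidden (green i) (green i') white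
  | yellow_yellow_yellow : BaseForbidden yellow yellow yellow
  | yellow_yellow_black : BaseForbidden yellow yellow black
  | red_red_red (j₁ j₂ k₂ k₃ l₁ l₃ : T) : ¬ (j₁ = l₁ ∧ j₂ = k₂ ∧ k₃ = l₃) →
      BaseForbidden (red j₁ j₂) (red k₂ k₃) (red l₁ l₃)
  | same_green_red (i : S) (j j' : T) : BaseForbidden (green i) (green i) (red j j')
  | green_green_red_diag (i i' : S) (j : T) : BaseForbidden (green i) (green i') (red j j)

/-- The forbidden triples of atoms: all Peircean transforms of the triples above. -/
def Forbidden {S T : Type*} (a b c : RainbowAtom S T) : Prop :=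
  ∃ a' b' c' : RainbowAtom S T,
    BaseForbidden a' b' c' ∧ (a, b, c) ∈ peirceanTransforms conv a' b' c'

end RainbowAtom

/-- The modified rainbow atom structure over `S` and `T`; the consistent triples are those that are
not forbidden. -/
def rainbowAtomStructure (S T : Type*) : AtomStructure (RainbowAtom S T) where
  ident := {RainbowAtom.one}
  conv := RainbowAtom.conv
  consistent a b c := ¬ RainbowAtom.Forbidden a b c

/-- The modified rainbow algebra `ℬ_{S,T}`: the complex algebra of the modified rainbow atom
structure. -/
abbrev RainbowAlgebra (S T : Type*) : Type _ := ComplexAlgebra (rainbowAtomStructure S T)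

/-! A representation labels the pairs of each equivalence class by atoms, with no forbidden triangle
and with a witness for every consistent path.

Necessity: all paths `green i`, `yellow` are consistent over a black edge from `x` to `y`, so there
are witnesses `z i` for all `i` at once. Between two of them, the green edges to `x` exclude white
and green, the yellow edges to `y` exclude black and yellow, so only red remains. The rule for red
triangles gives each witness an index in `T`, and distinct witnesses get distinct indices because
`red j j` is forbidden over two greens. Thus `S` injects into `T` (`IsNetwork.exists_injective`).

Sufficiency: finite networks are extended by one witness at a time (`IsNetwork.exists_labels`).
White, or else black, serves for the edge from an old node to the new one, unless the path is
green-yellow and the old node itself sees the two ends along green and yellow. Such old nodes form a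
red clique with distinct green edges to `x`. None of these has the colour that is asked for, as
otherwise the path would be realized already, so the clique has fewer than `|S| ≤ |T|` nodes. A red
index is still free for the new node. A generic limit of finite networks is saturated and yields the
representation. -/

namespace RainbowAtom

variable {S T : Type*}

/-! ### Forbidden triples of atoms -/

theorem conv_conv (a : RainbowAtom S T) : a.conv.conv = a := by
  cases a <;> rfl

theorem conv_one : (one : RainbowAtom S T).conv = one := rfl

theorem conv_injective : Function.Injective (conv : RainbowAtom S T → RainbowAtom S T) :=
  fun a b h => by rw [← conv_conv a, h, conv_conv]

theorem finite [Finite S] [Finite T] : Finite (RainbowAtom S T) := by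
  let f : Fin 4 ⊕ S ⊕ T × T → RainbowAtom S T
    | .inl 0 => one
    | .inl 1 => black
    | .inl 2 => white
    | .inl 3 => yellow
    | .inr (.inl i) => green i
    | .inr (.inr (j, j')) => red j j'
  refine Finite.of_surjective f ?_
  rintro (_ | _ | _ | _ | i | ⟨j, j'⟩)
  exacts [⟨.inl 0, rfl⟩, ⟨.inl 1, rfl⟩, ⟨.inl 2, rfl⟩, ⟨.inl 3, rfl⟩, ⟨.inr (.inl i), rfl⟩,
    ⟨.inr (.inr (j, j')), rfl⟩]

/-- `a` is one of the green atoms. -/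
def IsGreen (a : RainbowAtom S T) : Prop := ∃ i, a = green i

/-- `a` is one of the red atoms. -/
def IsRed (a : RainbowAtom S T) : Prop := ∃ j j', a = red j j'

theorem BaseForbidden.forbidden {a b c : RainbowAtom S T} (h : BaseForbidden a b c) :
    Forbidden a b c :=
  ⟨a, b, c, h, by simp [peirceanTransforms]⟩

/-- Invariance of the forbidden triples under the transform `(a, b, c) ↦ (a˘, c, b)`. -/
theorem Forbidden.left {a b c : RainbowAtom S T} (h : Forbidden a b c) :
    Forbidden a.conv c b := by
  obtain ⟨a', b', c', h, hm⟩ := h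
  refine ⟨a', b', c', h, ?_⟩
  simp only [peirceanTransforms, Set.mem_insert_iff, Set.mem_singleton_iff, Prod.mk.injEq] at hm ⊢
  rcases hm with ⟨rfl, rfl, rfl⟩ | ⟨rfl, rfl, rfl⟩ | ⟨rfl, rfl, rfl⟩ | ⟨rfl, rfl, rfl⟩ |
    ⟨rfl, rfl, rfl⟩ | ⟨rfl, rfl, rfl⟩ <;> simp [conv_conv]

/-- Invariance of the forbidden triples under the transform `(a, b, c) ↦ (b˘, a˘, c˘)`. -/
theorem Forbidden.reverse {a b c : RainbowAtom S T} (h : Forbidden a b c) :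
    Forbidden b.conv a.conv c.conv := by
  obtain ⟨a', b', c', h, hm⟩ := h
  refine ⟨a', b', c', h, ?_⟩
  simp only [peirceanTransforms, Set.mem_insert_iff, Set.mem_singleton_iff, Prod.mk.injEq] at hm ⊢
  rcases hm with ⟨rfl, rfl, rfl⟩ | ⟨rfl, rfl, rfl⟩ | ⟨rfl, rfl, rfl⟩ | ⟨rfl, rfl, rfl⟩ |
    ⟨rfl, rfl, rfl⟩ | ⟨rfl, rfl, rfl⟩ <;> simp [conv_conv]

/-- The transform `(a, b, c) ↦ (c, b˘, a)`. -/
theorem Forbidden.right {a b c : RainbowAtom S T} (h : Forbidden a b c) :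
    Forbidden c b.conv a := by
  simpa [conv_conv] using h.reverse.left.reverse

/-- Classification of the forbidden triples. -/
theorem Forbidden.cases {a b c : RainbowAtom S T} (h : Forbidden a b c) :
    (a = one ∧ b ≠ c) ∨ (b = one ∧ a ≠ c) ∨ (c = one ∧ a ≠ b.conv) ∨
    (IsGreen a ∧ IsGreen b ∧ (IsGreen c ∨ c = white)) ∨
    (IsGreen a ∧ IsGreen c ∧ b = white) ∨ (IsGreen b ∧ IsGreen c ∧ a = white) ∨
    (a = yellow ∧ b = yellow ∧ (c = yellow ∨ c = black)) ∨
    (a = yellow ∧ c = yellow ∧ b = black) ∨ (b = yellow ∧ c = yellow ∧ a = black) ∨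
    (∃ j₁ j₂ k₂ k₃ l₁ l₃, a = red j₁ j₂ ∧ b = red k₂ k₃ ∧ c = red l₁ l₃ ∧
      ¬ (j₁ = l₁ ∧ j₂ = k₂ ∧ k₃ = l₃)) ∨
    (∃ i i' j j', (a = green i ∧ b = green i' ∧ c = red j j' ∨
      a = green i ∧ c = green i' ∧ b = red j j' ∨
      b = green i ∧ c = green i' ∧ a = red j j') ∧ (i = i' ∨ j = j')) := by
  obtain ⟨a', b', c', h, hm⟩ := h
  simp only [peirceanTransforms, Set.mem_insert_iff, Set.mem_singleton_iff, Prod.mk.injEq] at hm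
  cases h with
  | one p q hne =>
    have := conv_injective.ne hne
    rcases hm with ⟨rfl, rfl, rfl⟩ | ⟨rfl, rfl, rfl⟩ | ⟨rfl, rfl, rfl⟩ | ⟨rfl, rfl, rfl⟩ |
      ⟨rfl, rfl, rfl⟩ | ⟨rfl, rfl, rfl⟩ <;> simp_all [conv_one, conv_conv] <;> grind
  | red_red_red =>
    rcases hm with ⟨rfl, rfl, rfl⟩ | ⟨rfl, rfl, rfl⟩ | ⟨rfl, rfl, rfl⟩ | ⟨rfl, rfl, rfl⟩ |
      ⟨rfl, rfl, rfl⟩ | ⟨rfl, rfl, rfl⟩ <;> simp_all [conv, IsGreen] <;> grind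
  | _ =>
    rcases hm with ⟨rfl, rfl, rfl⟩ | ⟨rfl, rfl, rfl⟩ | ⟨rfl, rfl, rfl⟩ | ⟨rfl, rfl, rfl⟩ |
      ⟨rfl, rfl, rfl⟩ | ⟨rfl, rfl, rfl⟩ <;> simp [conv, IsGreen]

theorem forbidden_one_left {a b : RainbowAtom S T} : Forbidden one a b ↔ a ≠ b := by
  refine ⟨?_, fun h => (BaseForbidden.one a b h).forbidden⟩
  rintro h rfl
  have := h.cases
  simp only [IsGreen, ne_eq, not_true_eq_false, and_false, false_or, reduceCtorEq, exists_false,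
    false_and] at this
  grind [conv]

theorem forbidden_one_middle {a b : RainbowAtom S T} : Forbidden a one b ↔ a ≠ b := by
  have : Forbidden a one b ↔ Forbidden one a.conv b.conv :=
    ⟨fun h => h.reverse, fun h => by simpa [conv_conv, conv_one] using h.reverse⟩
  rw [this, forbidden_one_left, conv_injective.ne_iff]

theorem forbidden_one_right {a b : RainbowAtom S T} : Forbidden a b one ↔ a ≠ b.conv := by
  have : Forbidden a b one ↔ Forbidden one b.conv a :=
    ⟨fun h => h.right, fun h => by simpa [conv_conv] using h.right⟩
  rw [this, forbidden_one_left, ne_comm]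

/-- Besides the identity rule, only the rule with two greens mentions white. Black is similar, with
two yellows. -/
theorem not_forbidden_white {a b : RainbowAtom S T} (ha : a ≠ one) (hb : b ≠ one)
    (h : ¬ (a.IsGreen ∧ b.IsGreen)) : ¬ Forbidden a b white := by
  intro hn
  have h1 := hn.cases
  have h2 : ¬ (white : RainbowAtom S T).IsGreen := by simp [IsGreen]
  simp only [ha, hb, h2, reduceCtorEq, false_and, and_false, exists_false, or_false, false_or,
    or_true, and_true] at h1
  exact h h1

theorem not_forbidden_black {a b : RainbowAtom S T} (ha : a ≠ one) (hb : b ≠ one)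
    (h : ¬ (a = yellow ∧ b = yellow)) : ¬ Forbidden a b black := by
  intro hn
  have h1 := hn.cases
  have h2 : ¬ (black : RainbowAtom S T).IsGreen := by simp [IsGreen]
  simp only [ha, hb, h2, reduceCtorEq, false_and, and_false, exists_false, or_false, false_or,
    or_true, and_true] at h1
  exact h h1

/-- Without the identity, the only forbidden triples with more than one entry among white, black and
red are the all-red ones. Hence white, black and red edges to a new node can clash with each other
only if both are red. -/
theorem not_forbidden_of_not_isRed {a b c : RainbowAtom S T} (ha : a ≠ one)
    (hb : b = white ∨ b = black ∨ b.IsRed) (hc : c = white ∨ c = black ∨ c.IsRed)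
    (h : ¬ (b.IsRed ∧ c.IsRed)) : ¬ Forbidden a b c := by
  intro hn
  have h1 := hn.cases
  rcases hb with rfl | rfl | ⟨j, j', rfl⟩ <;> rcases hc with rfl | rfl | ⟨k, k', rfl⟩ <;>
    first
    | exact h ⟨⟨_, _, rfl⟩, _, _, rfl⟩
    | simp [ha, IsGreen] at h1

end RainbowAtom

/-! ### Networks and red cliques -/

variable {S : Type u} {T : Type v} {X : Type*}

open RainbowAtom

/-- An atomic network on the set `D` of nodes: a labelling of the pairs of nodes by atoms in which
the identity labels exactly the diagonal and no triangle is forbidden. -/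
structure IsNetwork (D : Set X) (L : X → X → RainbowAtom S T) : Prop where
  eq_one_iff : ∀ x ∈ D, ∀ y ∈ D, L x y = one ↔ x = y
  conv : ∀ x ∈ D, ∀ y ∈ D, L y x = (L x y).conv
  not_forbidden : ∀ x ∈ D, ∀ y ∈ D, ∀ z ∈ D, ¬ Forbidden (L x y) (L y z) (L x z)

namespace IsNetwork

variable {D R : Set X} {L : X → X → RainbowAtom S T} {x y : X}

/-- Two distinct nodes that both see `x` along green edges and `y` along yellow edges are joined by
a red edge. -/
theorem exists_red (h : IsNetwork D L) (hx : x ∈ D) (hy : y ∈ D) {u v : X} (hu : u ∈ D)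
    (hv : v ∈ D) (huv : u ≠ v) (hux : (L u x).IsGreen) (hvx : (L v x).IsGreen)
    (huy : L u y = yellow) (hvy : L v y = yellow) : (L u v).IsRed := by
  obtain ⟨i, hi⟩ := hux
  obtain ⟨i', hi'⟩ := hvx
  have h1 := h.not_forbidden u hu v hv x hx
  have h2 := h.not_forbidden u hu v hv y hy
  have h3 := (h.eq_one_iff u hu v hv).not.2 huv
  rw [hi, hi'] at h1
  rw [huy, hvy] at h2
  match hL : L u v with
  | one => exact absurd hL h3
  | black =>
    rw [hL] at h2
    exact absurd (BaseForbidden.yellow_yellow_black.forbidden.right.left) h2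
  | white =>
    rw [hL] at h1
    exact absurd ((BaseForbidden.green_green_white i i').forbidden.right) h1
  | yellow =>
    rw [hL] at h2
    exact absurd BaseForbidden.yellow_yellow_yellow.forbidden h2
  | green k =>
    rw [hL] at h1
    exact absurd (BaseForbidden.green_green_green k i' i).forbidden h1
  | red j j' => exact ⟨j, j', rfl⟩

/-- The edges of a red clique are labelled by the pairs of indices of their ends. -/
theorem exists_index [Nonempty T] (h : IsNetwork D L) (hR : R ⊆ D)
    (hred : ∀ u ∈ R, ∀ v ∈ R, u ≠ v → (L u v).IsRed) :
    ∃ α : X → T, ∀ u ∈ R, ∀ v ∈ R, u ≠ v → L u v = red (α u) (α v) := by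
  have key : ∀ u, ∃ t : T, u ∈ R → ∀ v ∈ R, u ≠ v → ∃ t', L u v = red t t' := by
    intro u
    -- The index of `u` is the first index of any red edge leaving `u` inside `R`; the red rule
    -- makes it independent of the edge. Without such an edge any index will do.
    by_cases hu : u ∈ R ∧ ∃ v ∈ R, u ≠ v
    · obtain ⟨hu, v, hv, huv⟩ := hu
      obtain ⟨j, j', hj⟩ := hred u hu v hv huv
      refine ⟨j, fun _ w hw huw => ?_⟩
      obtain ⟨k, k', hk⟩ := hred u hu w hw huw
      refine ⟨k', ?_⟩
      by_cases hvw : v = w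
      · subst hvw
        rw [hj] at hk ⊢
        cases hk
        rfl
      · obtain ⟨l, l', hl⟩ := hred v hv w hw hvw
        have := h.not_forbidden u (hR hu) v (hR hv) w (hR hw)
        rw [hj, hk, hl] at this
        have h2 := not_imp_comm.1 (fun hn => (BaseForbidden.red_red_red _ _ _ _ _ _ hn).forbidden)
          this
        rw [hk, h2.1]
    · obtain ⟨t⟩ := ‹Nonempty T›
      exact ⟨t, fun hu' v hv huv => absurd ⟨hu', v, hv, huv⟩ hu⟩
  choose α hα using key
  refine ⟨α, fun u hu v hv huv => ?_⟩
  obtain ⟨t, ht⟩ := hα u hu v hv huv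
  -- The second index is the first index of the converse edge.
  obtain ⟨t', ht'⟩ := hα v hv u hu huv.symm
  have := h.conv u (hR hu) v (hR hv)
  rw [ht, ht'] at this
  simp only [RainbowAtom.conv, red.injEq] at this
  rw [ht, this.1]

/-- Indices for the clique of all nodes that see `x` along green and `y` along yellow edges. -/
theorem exists_injOn_index [Nonempty T] (h : IsNetwork D L) (hR : R ⊆ D) (hx : x ∈ D) (hy : y ∈ D)
    (hRx : ∀ u ∈ R, (L u x).IsGreen) (hRy : ∀ u ∈ R, L u y = yellow) :
    ∃ α : X → T, Set.InjOn α R ∧ ∀ u ∈ R, ∀ v ∈ R, u ≠ v → L u v = red (α u) (α v) := by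
  obtain ⟨α, hα⟩ := h.exists_index hR fun u hu v hv huv =>
    h.exists_red hx hy (hR hu) (hR hv) huv (hRx u hu) (hRx v hv) (hRy u hu) (hRy v hv)
  refine ⟨α, fun u hu v hv he => ?_, hα⟩
  -- Equal indices would put a diagonal red atom over two green edges to `x`.
  by_contra huv
  obtain ⟨i, hi⟩ := hRx u hu
  obtain ⟨i', hi'⟩ := hRx v hv
  have h1 := h.not_forbidden u (hR hu) x hx v (hR hv)
  rw [h.conv v (hR hv) x hx, hi, hi', hα u hu v hv huv, he] at h1
  exact h1 (BaseForbidden.green_green_red_diag i i' _).forbidden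

/-- Distinct nodes of the same clique have different green edges to `x`. -/
theorem injOn_green (h : IsNetwork D L) (hR : R ⊆ D) (hx : x ∈ D) (hy : y ∈ D)
    (hRx : ∀ u ∈ R, (L u x).IsGreen) (hRy : ∀ u ∈ R, L u y = yellow) :
    Set.InjOn (fun u => L u x) R := by
  intro u hu v hv (he : L u x = L v x)
  by_contra huv
  obtain ⟨j, j', hj⟩ := h.exists_red hx hy (hR hu) (hR hv) huv (hRx u hu) (hRx v hv) (hRy u hu)
    (hRy v hv)
  obtain ⟨i, hi⟩ := hRx u hu
  have h1 := h.not_forbidden u (hR hu) x hx v (hR hv)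
  rw [h.conv v (hR hv) x hx, ← he, hi, hj] at h1
  exact h1 (BaseForbidden.same_green_red i _ _).forbidden

end IsNetwork

/-- If the network on a set of nodes realizes a black edge and all green-yellow paths over it,
then there are at least as many red indices as green atoms. -/
theorem IsNetwork.exists_injective [Nontrivial S] {D : Set X} {L : X → X → RainbowAtom S T}
    (h : IsNetwork D L) {x y : X} (hx : x ∈ D) (hy : y ∈ D)
    (hz : ∀ i : S, ∃ z ∈ D, L x z = green i ∧ L z y = yellow) :
    ∃ f : S → T, Function.Injective f := by
  choose z hzD hzx hzy using hz
  have hzx' : ∀ i, L (z i) x = green i := fun i => by rw [h.conv x hx _ (hzD i), hzx]; rfl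
  have hinj : Function.Injective z := fun i i' hi => by
    have := hzx i
    rw [hi, hzx i'] at this
    cases this
    rfl
  -- Two green atoms force a red edge, hence an element of `T`.
  obtain ⟨i, i', hii'⟩ := exists_pair_ne S
  obtain ⟨t, -⟩ := h.exists_red hx hy (hzD i) (hzD i') (hinj.ne hii') ⟨i, hzx' i⟩ ⟨i', hzx' i'⟩
    (hzy i) (hzy i')
  have : Nonempty T := ⟨t⟩
  obtain ⟨α, hα, -⟩ := h.exists_injOn_index (R := Set.range z) (by rintro _ ⟨i, rfl⟩; exact hzD i)
    hx hy (by rintro _ ⟨i, rfl⟩; exact ⟨i, hzx' i⟩) (by rintro _ ⟨i, rfl⟩; exact hzy i)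
  exact ⟨α ∘ z, fun i i' hi => hinj (hα ⟨i, rfl⟩ ⟨i', rfl⟩ hi)⟩

/-! ### From a representation to a large set of red indices -/

namespace RelationRepresentation

variable {E : Setoid X}

theorem mem_mono (h : RelationRepresentation (RainbowAlgebra S T) E)
    {P Q : Set (RainbowAtom S T)} (hPQ : P ⊆ Q) {p : X × X}
    (hp : p ∈ (h.toFun P).1) : p ∈ (h.toFun Q).1 := by
  have h1 := h.map_sup P Q
  rw [show (P ⊔ Q : RainbowAlgebra S T) = Q from Set.union_eq_self_of_subset_left hPQ] at h1
  rw [h1]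
  exact Or.inl hp

theorem not_mem_of_disjoint (h : RelationRepresentation (RainbowAlgebra S T) E)
    {P Q : Set (RainbowAtom S T)} (hPQ : Disjoint P Q) {p : X × X}
    (hp : p ∈ (h.toFun P).1) : p ∉ (h.toFun Q).1 := by
  intro hq
  have h1 := h.mem_mono hPQ.symm.subset_compl_right hq
  have h2 := h.map_compl P
  rw [show (Pᶜ : Set (RainbowAtom S T)) = (Compl.compl (show RainbowAlgebra S T from P)) from rfl,
    h2] at h1
  exact h1.2 hp

theorem mem_conv (h : RelationRepresentation (RainbowAlgebra S T) E)
    (P : Set (RainbowAtom S T)) {x y : X} :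
    (y, x) ∈ (h.toFun ({a | ∃ b ∈ P, b.conv = a} : Set (RainbowAtom S T))).1 ↔
      (x, y) ∈ (h.toFun P).1 :=
  iff_of_eq (congrArg (fun R : ProperAlgebra E => (y, x) ∈ R.1) (h.map_conv P))

theorem mem_comp (h : RelationRepresentation (RainbowAlgebra S T) E)
    (P Q : Set (RainbowAtom S T)) {x y : X} :
    (x, y) ∈ (h.toFun ({c | ∃ a b, a ∈ P ∧ b ∈ Q ∧ ¬ Forbidden a b c} :
      Set (RainbowAtom S T))).1 ↔ ∃ z, (x, z) ∈ (h.toFun P).1 ∧ (z, y) ∈ (h.toFun Q).1 :=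
  iff_of_eq (congrArg (fun R : ProperAlgebra E => (x, y) ∈ R.1) (h.map_comp P Q))

/-- A representation need only preserve finite joins; this suffices because there are finitely many
atoms. -/
theorem exists_atom [Finite S] [Finite T]
    (h : RelationRepresentation (RainbowAlgebra S T) E) {P : Set (RainbowAtom S T)}
    {p : X × X} (hp : p ∈ (h.toFun P).1) :
    ∃ a ∈ P, p ∈ (h.toFun ({a} : Set (RainbowAtom S T))).1 := by
  have : Finite (RainbowAtom S T) := RainbowAtom.finite
  have hfin := P.toFinite
  induction P, hfin using Set.Finite.induction_on with
  | empty =>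
    have h1 := h.map_bot
    rw [show (⊥ : RainbowAlgebra S T) = (∅ : Set (RainbowAtom S T)) from rfl] at h1
    rw [h1] at hp
    exact hp.elim
  | @insert a P _ _ ih =>
    have h1 := h.map_sup ({a} : Set (RainbowAtom S T)) P
    rw [show (({a} : Set (RainbowAtom S T)) ⊔ P : RainbowAlgebra S T) =
      (insert a P : Set (RainbowAtom S T)) from rfl] at h1
    rw [h1] at hp
    rcases hp with hp | hp
    · exact ⟨a, by simp, hp⟩
    · obtain ⟨b, hb, hb'⟩ := ih hp
      exact ⟨b, by simp [hb], hb'⟩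

/-- The pairs in an equivalence class are labelled by atoms. -/
theorem exists_isNetwork [Finite S] [Finite T]
    (h : RelationRepresentation (RainbowAlgebra S T) E) (x₀ : X) :
    ∃ L : X → X → RainbowAtom S T, IsNetwork {x | E x₀ x} L ∧
      ∀ a x y, (x, y) ∈ (h.toFun ({a} : Set (RainbowAtom S T))).1 → L x y = a := by
  have huniq : ∀ a b p, p ∈ (h.toFun ({a} : Set (RainbowAtom S T))).1 →
      p ∈ (h.toFun ({b} : Set (RainbowAtom S T))).1 → a = b := fun a b p ha hb => by
    by_contra hab
    exact h.not_mem_of_disjoint (Set.disjoint_singleton.2 hab) ha hb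
  have hex : ∀ x y, ∃ a, E x y → (x, y) ∈ (h.toFun ({a} : Set (RainbowAtom S T))).1 := by
    intro x y
    by_cases hxy : E x y
    · have h1 : (x, y) ∈ (h.toFun ⊤).1 := by
        rw [h.map_top]
        exact hxy
      obtain ⟨a, -, ha⟩ := h.exists_atom (P := Set.univ) h1
      exact ⟨a, fun _ => ha⟩
    -- A dummy label: pairs outside `E` play no role.
    · exact ⟨one, fun h => absurd h hxy⟩
  choose L hL using hex
  have hE : ∀ {x y}, E x₀ x → E x₀ y → E x y := fun hx hy => E.trans (E.symm hx) hy
  have hLa : ∀ a x y, (x, y) ∈ (h.toFun ({a} : Set (RainbowAtom S T))).1 → L x y = a :=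
    fun a x y ha => huniq _ _ _ (hL x y ((h.toFun _).2 ha)) ha
  refine ⟨L, ⟨fun x hx y hy => ?_, fun x hx y hy => ?_, fun x hx y hy z hz hf => ?_⟩, hLa⟩
  · have h1 : (x, y) ∈ (h.toFun ({one} : Set (RainbowAtom S T))).1 ↔ x = y := by
      have := h.map_ident
      rw [show (RelationTypeAlgebra.ident : RainbowAlgebra S T) = ({one} : Set (RainbowAtom S T))
        from rfl] at this
      rw [this]
      rfl
    rw [← h1]
    exact ⟨fun h2 => h2 ▸ hL x y (hE hx hy), hLa _ _ _⟩
  · apply hLa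
    have h1 := (h.mem_conv {L x y}).2 (hL x y (hE hx hy))
    simpa using h1
  · have h1 := (h.mem_comp {L x y} {L y z}).2 ⟨y, hL x y (hE hx hy), hL y z (hE hy hz)⟩
    refine h.not_mem_of_disjoint ?_ h1 (hL x z (hE hx hz))
    simpa using hf

end RelationRepresentation

theorem Representable.card_le [Finite S] [Finite T] (hS : 2 ≤ Nat.card S)
    (h : Representable.{_, w} (RainbowAlgebra S T)) : Nat.card S ≤ Nat.card T := by
  obtain ⟨X, E, ⟨h⟩⟩ := h
  have : Nontrivial S := Finite.one_lt_card_iff_nontrivial.1 hS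
  -- By injectivity, black cannot be represented by the empty relation.
  have hb : ∃ p, p ∈ (h.toFun ({black} : Set (RainbowAtom S T))).1 := by
    by_contra hn
    have h1 : h.toFun ({black} : Set (RainbowAtom S T)) = h.toFun ⊥ := by
      rw [h.map_bot]
      exact Subtype.ext (Set.eq_empty_iff_forall_notMem.2 (not_exists.1 hn))
    have h2 : ({black} : Set (RainbowAtom S T)) = ∅ := h.injective h1
    exact Set.singleton_ne_empty _ h2
  obtain ⟨⟨x, y⟩, hxy⟩ := hb
  obtain ⟨L, hL, hLa⟩ := h.exists_isNetwork x
  have hxyE : E x y := (h.toFun _).2 hxy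
  obtain ⟨f, hf⟩ := hL.exists_injective (E.refl x) hxyE fun i => by
    obtain ⟨z, hz1, hz2⟩ := (h.mem_comp {green i} {yellow}).1 <| by
      refine h.mem_mono (P := {black}) ?_ hxy
      rintro _ rfl
      refine ⟨green i, yellow, rfl, rfl, fun hf => ?_⟩
      simpa [IsGreen] using hf.cases
    exact ⟨z, (h.toFun _).2 hz1, hLa _ _ _ hz1, hLa _ _ _ hz2⟩
  exact Nat.card_le_card_of_injective f hf

/-! ### Extending a network by one node -/

namespace IsNetwork

/-- Adding a node `z` to a network, the edges from the old nodes `u` to `z` being labelled by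
`f u`. -/
theorem exists_extension [DecidableEq X] {D : Set X} {L : X → X → RainbowAtom S T}
    (h : IsNetwork D L) {z : X} (hz : z ∉ D) (f : X → RainbowAtom S T) (hf : ∀ u ∈ D, f u ≠ one)
    (hL : ∀ u ∈ D, ∀ v ∈ D, ¬ Forbidden (L u v) (f v) (f u)) :
    ∃ L' : X → X → RainbowAtom S T, IsNetwork (insert z D) L' ∧
      (∀ u ∈ D, ∀ v ∈ D, L' u v = L u v) ∧ ∀ u ∈ D, L' u z = f u := by
  have hf' : ∀ u ∈ D, (f u).conv ≠ one := fun u hu h => hf u hu (conv_injective h)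
  have hne : ∀ u ∈ D, u ≠ z := fun u hu h => hz (h ▸ hu)
  have hne' : ∀ u ∈ D, z ≠ u := fun u hu h => hz (h ▸ hu)
  let L' : X → X → RainbowAtom S T := fun u v =>
    if u = z then (if v = z then one else (f v).conv) else if v = z then f u else L u v
  have h1 : L' z z = one := by simp [L']
  have h2 : ∀ u ∈ D, L' u z = f u := fun u hu => by simp [L', hne u hu]
  have h3 : ∀ u ∈ D, L' z u = (f u).conv := fun u hu => by simp [L', hne u hu]
  have h4 : ∀ u ∈ D, ∀ v ∈ D, L' u v = L u v := fun u hu v hv => by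
    simp [L', hne u hu, hne v hv]
  refine ⟨L', ⟨?_, ?_, ?_⟩, h4, h2⟩
  · rintro u (rfl | hu) v (rfl | hv)
    · simp [h1]
    · simp [h3 v hv, hf' v hv, hne' v hv]
    · simp [h2 u hu, hf u hu, hne u hu]
    · rw [h4 u hu v hv, h.eq_one_iff u hu v hv]
  · rintro u (rfl | hu) v (rfl | hv)
    · rw [h1, conv_one]
    · rw [h3 v hv, h2 v hv, conv_conv]
    · rw [h3 u hu, h2 u hu]
    · rw [h4 u hu v hv, h4 v hv u hu, h.conv u hu v hv]
  -- If the new node occurs more than once, the triangle falls under the identity rule; if it occurs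
  -- once, the triangle is a Peircean transform of one in `hL`.
  · rintro u (rfl | hu) v (rfl | hv) w (rfl | hw)
    · rw [h1, forbidden_one_left]; simp
    · rw [h1, forbidden_one_left]; simp
    · rw [h1, h3 v hv, h2 v hv, forbidden_one_right]; simp
    · rw [h3 v hv, h3 w hw, h4 v hv w hw]
      intro hn
      exact hL v hv w hw (by simpa only [conv_conv] using hn.left.right)
    · rw [h1, forbidden_one_middle]; simp
    · rw [h3 w hw, h2 u hu, h4 u hu w hw]
      intro hn
      exact hL u hu w hw (by simpa only [conv_conv] using hn.right)
    · rw [h2 v hv, h2 u hu, h4 u hu v hv]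
      exact hL u hu v hv
    · rw [h4 u hu v hv, h4 v hv w hw, h4 u hu w hw]
      exact h.not_forbidden u hu v hv w hw

/-- Labels `white`, `black` and `ρ u`, in this order of preference, for the edges from `u` to a new
node that is to be joined to `x` by `a` and to `y` by `c`. -/
theorem exists_labels_of_red {D : Set X} {L : X → X → RainbowAtom S T} (h : IsNetwork D L) {x y : X}
    (hx : x ∈ D) (hy : y ∈ D) {a c : RainbowAtom S T} (ha : a ≠ one) (hc : c ≠ one)
    (hxy : x = y → a = c) (hac : ¬ Forbidden (L x y) c a) (ρ : X → RainbowAtom S T) (R : Set X)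
    (hR : ∀ u ∈ D, u ≠ x → u ≠ y →
      ((L u x).IsGreen ∧ a.IsGreen ∨ (L u y).IsGreen ∧ c.IsGreen) →
      (L u x = yellow ∧ a = yellow ∨ L u y = yellow ∧ c = yellow) → u ∈ R)
    (hρ : ∀ u ∈ R, (ρ u).IsRed) (hρx : ∀ u ∈ R, u ∈ D → ¬ Forbidden (L u x) a (ρ u))
    (hρy : ∀ u ∈ R, u ∈ D → ¬ Forbidden (L u y) c (ρ u))
    (hρR : ∀ u ∈ R, ∀ v ∈ R, u ∈ D → v ∈ D → u ≠ v → ¬ Forbidden (L u v) (ρ v) (ρ u)) :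
    ∃ f : X → RainbowAtom S T, f x = a ∧ f y = c ∧ (∀ u ∈ D, f u ≠ one) ∧
      ∀ u ∈ D, ∀ v ∈ D, ¬ Forbidden (L u v) (f v) (f u) := by
  classical
  -- `W u` is the obstruction to white at `u`, and `B u` the obstruction to black.
  let W : X → Prop := fun u => (L u x).IsGreen ∧ a.IsGreen ∨ (L u y).IsGreen ∧ c.IsGreen
  let B : X → Prop := fun u => L u x = yellow ∧ a = yellow ∨ L u y = yellow ∧ c = yellow
  let f : X → RainbowAtom S T := fun u =>
    if u = x then a else if u = y then c else if ¬ W u then white else if ¬ B u then black else ρ u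
  have hfx : f x = a := by simp [f]
  have hfy : f y = c := by
    by_cases hyx : y = x
    · rw [hyx, hfx, hxy hyx.symm]
    · simp [f, hyx]
  have hf : ∀ u ∈ D, u ≠ x → u ≠ y → (f u = white ∧ ¬ W u) ∨ (f u = black ∧ ¬ B u) ∨
      (f u = ρ u ∧ u ∈ R) := by
    intro u hu hux huy
    by_cases hW : W u
    · by_cases hB : B u
      · exact .inr (.inr ⟨by simp [f, hux, huy, hW, hB], hR u hu hux huy hW hB⟩)
      · exact .inr (.inl ⟨by simp [f, hux, huy, hW, hB], hB⟩)
    · exact .inl ⟨by simp [f, hux, huy, hW], hW⟩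
  have hone : ∀ u ∈ D, f u ≠ one := by
    intro u hu
    by_cases hux : u = x
    · rwa [hux, hfx]
    by_cases huy : u = y
    · rwa [huy, hfy]
    rcases hf u hu hux huy with h | h | ⟨h, h'⟩
    · simp [h.1]
    · simp [h.1]
    · obtain ⟨j, j', hj⟩ := hρ u h'
      simp [h, hj]
  have key : ∀ u ∈ D, ∀ v ∈ D, u ≠ x → u ≠ y → u ≠ v → ¬ Forbidden (L u v) (f v) (f u) := by
    intro u hu v hv hux huy huv
    have hone1 : L u v ≠ one := (h.eq_one_iff u hu v hv).not.2 huv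
    by_cases hvx : v = x
    · subst hvx
      rw [hfx]
      rcases hf u hu hux huy with ⟨h1, h2⟩ | ⟨h1, h2⟩ | ⟨h1, h2⟩
      · rw [h1]
        exact not_forbidden_white hone1 ha fun h3 => h2 (.inl h3)
      · rw [h1]
        exact not_forbidden_black hone1 ha fun h3 => h2 (.inl h3)
      · rw [h1]
        exact hρx u h2 hu
    by_cases hvy : v = y
    · subst hvy
      rw [hfy]
      rcases hf u hu hux huy with ⟨h1, h2⟩ | ⟨h1, h2⟩ | ⟨h1, h2⟩
      · rw [h1]
        exact not_forbidden_white hone1 hc fun h3 => h2 (.inr h3)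
      · rw [h1]
        exact not_forbidden_black hone1 hc fun h3 => h2 (.inr h3)
      · rw [h1]
        exact hρy u h2 hu
    have hpas : ∀ w ∈ D, w ≠ x → w ≠ y → f w = white ∨ f w = black ∨ (f w).IsRed := by
      intro w hw hwx hwy
      rcases hf w hw hwx hwy with h1 | h1 | h1
      · exact .inl h1.1
      · exact .inr (.inl h1.1)
      · exact .inr (.inr (h1.1 ▸ hρ w h1.2))
    by_cases hr : (f v).IsRed ∧ (f u).IsRed
    · obtain ⟨⟨j, j', h1⟩, k, k', h2⟩ := hr
      have h3 := hf u hu hux huy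
      have h4 := hf v hv hvx hvy
      simp only [h2, reduceCtorEq, false_and, false_or] at h3
      simp only [h1, reduceCtorEq, false_and, false_or] at h4
      rw [h1, h2, h3.1, h4.1]
      exact hρR u h3.2 v h4.2 hu hv huv
    · exact not_forbidden_of_not_isRed hone1 (hpas v hv hvx hvy) (hpas u hu hux huy) hr
  have hself : ∀ u ∈ D, ¬ Forbidden (L u u) (f u) (f u) := fun u hu => by
    rw [(h.eq_one_iff u hu u hu).2 rfl, forbidden_one_left]
    simp
  refine ⟨f, hfx, hfy, hone, fun u hu v hv => ?_⟩
  by_cases huv : u = v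
  · subst huv
    exact hself u hu
  by_cases hu' : u ≠ x ∧ u ≠ y
  · exact key u hu v hv hu'.1 hu'.2 huv
  have hswap : ¬ Forbidden (L v u) (f u) (f v) → ¬ Forbidden (L u v) (f v) (f u) :=
    fun h1 h2 => h1 (by rw [h.conv u hu v hv]; exact h2.left)
  by_cases hv' : v ≠ x ∧ v ≠ y
  · exact hswap (key v hv u hu hv'.1 hv'.2 (Ne.symm huv))
  -- What remains is the triangle on `x`, `y` and the new node, in either orientation.
  have hxy' : ¬ Forbidden (L x y) (f y) (f x) := by rwa [hfx, hfy]
  have : (u = x ∧ v = y) ∨ (u = y ∧ v = x) := by grind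
  rcases this with ⟨rfl, rfl⟩ | ⟨rfl, rfl⟩
  · exact hxy'
  · exact hswap hxy'

/-- Labels for a new node joined to `x` by a green and to `y` by a yellow edge. -/
theorem exists_labels_of_green_yellow [Finite S] [Finite T] (hST : Nat.card S ≤ Nat.card T)
    {D : Set X} {L : X → X → RainbowAtom S T} (h : IsNetwork D L) {x y : X}
    (hx : x ∈ D) (hy : y ∈ D) {i : S} (hxy : ¬ Forbidden (L x y) yellow (green i))
    (hxy' : x ≠ y)
    (hno : ∀ u ∈ D, ¬ (L u x = green i ∧ L u y = yellow)) :
    ∃ f : X → RainbowAtom S T, f x = green i ∧ f y = yellow ∧ (∀ u ∈ D, f u ≠ one) ∧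
      ∀ u ∈ D, ∀ v ∈ D, ¬ Forbidden (L u v) (f v) (f u) := by
  let R : Set X := {u | u ∈ D ∧ (L u x).IsGreen ∧ L u y = yellow}
  have hRD : R ⊆ D := fun u hu => hu.1
  have hRx : ∀ u ∈ R, (L u x).IsGreen := fun u hu => hu.2.1
  have hRy : ∀ u ∈ R, L u y = yellow := fun u hu => hu.2.2
  have hS : 0 < Nat.card S := Nat.card_pos_iff.2 ⟨⟨i⟩, inferInstance⟩
  have : Nonempty T := (Nat.card_pos_iff.1 (hS.trans_le hST)).1
  obtain ⟨α, hα, hαL⟩ := h.exists_injOn_index hRD hx hy hRx hRy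
  have hgreen := h.injOn_green hRD hx hy hRx hRy
  -- If the clique used up all of `T`, its distinct green edges to `x` would inject `T` into `S`. As
  -- `|S| ≤ |T|`, every green atom would occur, including `green i`, against `hno`.
  obtain ⟨t, ht⟩ : ∃ t, ∀ u ∈ R, α u ≠ t := by
    by_contra! hcon
    choose β hβR hβ using hcon
    choose γ hγ using fun t => hRx (β t) (hβR t)
    have hγinj : Function.Injective γ := fun t t' he => by
      rw [← hβ t, ← hβ t']
      congr 1
      refine hgreen (hβR t) (hβR t') ?_
      simp only [hγ, he]
    have hγsurj : Function.Surjective γ :=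
      ((Nat.bijective_iff_injective_and_card γ).2
        ⟨hγinj, (Nat.card_le_card_of_injective γ hγinj).antisymm hST⟩).2
    obtain ⟨t, ht⟩ := hγsurj i
    exact hno (β t) (hRD (hβR t)) ⟨by rw [hγ, ht], hRy _ (hβR t)⟩
  -- The new node gets index `t`. Towards `x` the red edge is off the diagonal and lies over two
  -- different greens; towards `y` it lies over two yellows; inside the clique the indices match.
  refine h.exists_labels_of_red hx hy (by simp) (by simp) (fun h => absurd h hxy') hxy
    (fun u => red (α u) t) R ?_ (fun u _ => ⟨_, _, rfl⟩) ?_ ?_ ?_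
  · intro u hu _ _ h1 h2
    simp only [IsGreen, reduceCtorEq, exists_false, and_false, or_false, and_true, false_or]
      at h1 h2
    exact ⟨hu, h1.1, h2⟩
  · intro u hu _ hn
    obtain ⟨i', hi'⟩ := hRx u hu
    have hne : i' ≠ i := fun he => hno u (hRD hu) ⟨by rw [hi', he], hRy u hu⟩
    have h1 := hn.cases
    have h2 := ht u hu
    simp only [hi', IsGreen] at h1
    grind
  · intro u hu _ hn
    have h1 := hn.cases
    simp only [hRy u hu, IsGreen] at h1
    grind
  · intro u hu v hv _ _ huv hn
    have h1 := hn.cases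
    simp only [hαL u hu v hv huv, IsGreen] at h1
    grind

/-- Only a green-yellow path, in one of the two orders, can block both white and black at a node
other than its ends. -/
theorem exists_labels [Finite S] [Finite T] (hST : Nat.card S ≤ Nat.card T)
    {D : Set X} {L : X → X → RainbowAtom S T} (h : IsNetwork D L) {x y : X}
    (hx : x ∈ D) (hy : y ∈ D) {a c : RainbowAtom S T} (ha : a ≠ one) (hc : c ≠ one)
    (hac : ¬ Forbidden (L x y) c a) (hno : ∀ u ∈ D, ¬ (L x u = a ∧ L y u = c)) :
    ∃ f : X → RainbowAtom S T, f x = a ∧ f y = c ∧ (∀ u ∈ D, f u ≠ one) ∧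
      ∀ u ∈ D, ∀ v ∈ D, ¬ Forbidden (L u v) (f v) (f u) := by
  have hxy : x = y → a = c := by
    rintro rfl
    rw [(h.eq_one_iff x hx x hx).2 rfl, forbidden_one_left, not_not] at hac
    exact hac.symm
  by_cases h1 : a.IsGreen ∧ c = yellow
  · obtain ⟨⟨i, rfl⟩, rfl⟩ := h1
    exact h.exists_labels_of_green_yellow hST hx hy hac (fun he => by simpa using hxy he)
      fun u hu hn => hno u hu ⟨by rw [h.conv u hu x hx, hn.1]; rfl,
        by rw [h.conv u hu y hy, hn.2]; rfl⟩
  by_cases h2 : c.IsGreen ∧ a = yellow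
  · obtain ⟨⟨i, rfl⟩, rfl⟩ := h2
    obtain ⟨f, hfy, hfx, hf⟩ := h.exists_labels_of_green_yellow hST hy hx
      (fun hn => hac (by simpa [h.conv y hy x hx] using hn.left))
      (fun he => by simpa using hxy he.symm) fun u hu hn => hno u hu
        ⟨by rw [h.conv u hu x hx, hn.2]; rfl, by rw [h.conv u hu y hy, hn.1]; rfl⟩
    exact ⟨f, hfx, hfy, hf⟩
  -- No node needs red here, so `R` is empty and the value of `ρ` is a dummy.
  refine h.exists_labels_of_red hx hy ha hc hxy hac (fun _ => white) ∅ ?_ (by simp) (by simp)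
    (by simp) (by simp)
  intro u _ _ _ h3 h4
  have h5 : ¬ (yellow : RainbowAtom S T).IsGreen := by simp [IsGreen]
  grind

end IsNetwork

/-! ### Finite networks ordered by extension -/

/-- A network on a finite set of natural numbers. -/
structure FiniteNetwork (S : Type u) (T : Type v) where
  /-- the set of nodes -/
  nodes : Finset ℕ
  /-- the labelling -/
  label : ℕ → ℕ → RainbowAtom S T
  isNetwork : IsNetwork (nodes : Set ℕ) label

namespace FiniteNetwork

instance : Preorder (FiniteNetwork S T) where
  le M N := M.nodes ⊆ N.nodes ∧ ∀ u ∈ M.nodes, ∀ v ∈ M.nodes, N.label u v = M.label u v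
  le_refl M := ⟨subset_rfl, fun _ _ _ _ => rfl⟩
  le_trans M N K h1 h2 := ⟨h1.1.trans h2.1, fun u hu v hv =>
    (h2.2 u (h1.1 hu) v (h1.1 hv)).trans (h1.2 u hu v hv)⟩

theorem exists_extension (N : FiniteNetwork S T) {z : ℕ} (hz : z ∉ N.nodes)
    (f : ℕ → RainbowAtom S T) (hf : ∀ u ∈ N.nodes, f u ≠ one)
    (hL : ∀ u ∈ N.nodes, ∀ v ∈ N.nodes, ¬ Forbidden (N.label u v) (f v) (f u)) :
    ∃ M, N ≤ M ∧ z ∈ M.nodes ∧ ∀ u ∈ N.nodes, M.label u z = f u := by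
  obtain ⟨L', h1, h2, h3⟩ := N.isNetwork.exists_extension (by simpa using hz) f hf hL
  exact ⟨⟨insert z N.nodes, L', by simpa using h1⟩, ⟨Finset.subset_insert _ _, h2⟩,
    Finset.mem_insert_self _ _, h3⟩

/-- A new node can always be joined to all old ones by white edges. -/
theorem exists_mem_nodes (N : FiniteNetwork S T) (z : ℕ) : ∃ M, N ≤ M ∧ z ∈ M.nodes := by
  by_cases hz : z ∈ N.nodes
  · exact ⟨N, le_rfl, hz⟩
  obtain ⟨M, h1, h2, -⟩ := N.exists_extension hz (fun _ => white) (by simp) fun u hu v hv hn => by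
    have := hn.cases
    simp [IsGreen] at this
  exact ⟨M, h1, h2⟩

/-- The path `a`, `b` from `x` to `y` is realized in `N`, if it is consistent. -/
def Realizes (N : FiniteNetwork S T) (x y : ℕ) (a b : RainbowAtom S T) : Prop :=
  x ∈ N.nodes ∧ y ∈ N.nodes ∧
    (¬ Forbidden a b (N.label x y) → ∃ z ∈ N.nodes, N.label x z = a ∧ N.label z y = b)

theorem exists_realizes [Finite S] [Finite T] (hST : Nat.card S ≤ Nat.card T)
    (N : FiniteNetwork S T) (x y : ℕ) (a b : RainbowAtom S T) :
    ∃ M, N ≤ M ∧ M.Realizes x y a b := by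
  obtain ⟨N₁, hN₁, hx⟩ := N.exists_mem_nodes x
  obtain ⟨N₂, hN₂, hy⟩ := N₁.exists_mem_nodes y
  replace hx := hN₂.1 hx
  have hN := hN₁.trans hN₂
  by_cases hr : N₂.Realizes x y a b
  · exact ⟨N₂, hN, hr⟩
  simp only [Realizes, hx, hy, true_and, Classical.not_imp, not_exists] at hr
  obtain ⟨hc, hno⟩ := hr
  have hL := N₂.isNetwork
  have hxx := (hL.eq_one_iff x hx x hx).2 rfl
  have hyy := (hL.eq_one_iff y hy y hy).2 rfl
  -- A consistent path with an identity step is realized by `x` or `y` itself.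
  have ha : a ≠ one := by
    rintro rfl
    rw [forbidden_one_left, not_not] at hc
    exact hno x ⟨hx, hxx, hc.symm⟩
  have hb : b ≠ one := by
    rintro rfl
    rw [forbidden_one_middle, not_not] at hc
    exact hno y ⟨hy, hc.symm, hyy⟩
  -- Labels are read towards the new node, so at `y` the converse of `b` is prescribed.
  obtain ⟨f, hfx, hfy, hf1, hf2⟩ := hL.exists_labels hST hx hy ha
    (fun h => hb (conv_injective h) : b.conv ≠ one) (fun hn => hc <| by
      simpa [conv_conv] using hn.right) (fun u hu hn => hno u ⟨hu, hn.1, by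
        rw [hL.conv y hy u hu, hn.2, conv_conv]⟩)
  obtain ⟨z, hz⟩ := N₂.nodes.exists_notMem
  obtain ⟨M, hM, hzM, hfM⟩ := N₂.exists_extension hz f hf1 hf2
  refine ⟨M, hN.trans hM, hM.1 hx, hM.1 hy, fun _ => ⟨z, hzM, by rw [hfM x hx, hfx], ?_⟩⟩
  rw [M.isNetwork.conv y (hM.1 hy) z hzM, hfM y hy, hfy, conv_conv]

end FiniteNetwork

/-! ### Saturated networks and the representation -/

/-- A saturated network gives a representation, in which the pairs labelled by the atoms in `P`
represent `P`. -/
theorem IsNetwork.nonempty_representation {L : X → X → RainbowAtom S T} [Nonempty X]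
    (h : IsNetwork Set.univ L)
    (hL : ∀ x y a b, ¬ Forbidden a b (L x y) → ∃ z, L x z = a ∧ L z y = b) :
    Nonempty (RelationRepresentation (RainbowAlgebra S T) (⊤ : Setoid X)) := by
  -- Saturation over a loop: the path `a`, `a.conv` is consistent with the identity. So every atom
  -- occurs, which gives injectivity.
  have hsurj : ∀ a, ∃ x y, L x y = a := by
    intro a
    obtain ⟨x⟩ := ‹Nonempty X›
    obtain ⟨z, hz, -⟩ := hL x x a a.conv <| by
      rw [(h.eq_one_iff x trivial x trivial).2 rfl, forbidden_one_right, conv_conv]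
      simp
    exact ⟨x, z, hz⟩
  refine ⟨{
    toFun := fun P => ⟨{p : X × X | L p.1 p.2 ∈ (show Set (RainbowAtom S T) from P)},
      fun _ _ => trivial⟩
    injective := ?_
    map_bot := rfl
    map_top := Subtype.ext (Set.ext fun p => Iff.rfl)
    map_sup := fun P Q => rfl
    map_compl := fun P => Subtype.ext (Set.ext fun p => ⟨fun hp => ⟨trivial, hp⟩, fun hp => hp.2⟩)
    map_ident := Subtype.ext (Set.ext fun p => h.eq_one_iff p.1 trivial p.2 trivial)
    map_conv := fun P => Subtype.ext (Set.ext fun p => ?_)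
    map_comp := fun P Q => Subtype.ext (Set.ext fun p => ?_) }⟩
  · intro P Q hPQ
    refine Set.ext fun a => ?_
    obtain ⟨x, y, rfl⟩ := hsurj a
    exact iff_of_eq (congrArg (fun R : ProperAlgebra (⊤ : Setoid X) => (x, y) ∈ R.1) hPQ)
  · constructor
    · rintro ⟨b, hb, hb'⟩
      have h1 : L p.2 p.1 = b := by
        rw [h.conv p.1 trivial p.2 trivial, ← conv_conv b]
        exact congrArg _ hb'.symm
      have h2 : L p.2 p.1 ∈ (show Set (RainbowAtom S T) from P) := by rw [h1]; exact hb
      exact h2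
    · intro hp
      exact ⟨L p.2 p.1, hp, (h.conv p.2 trivial p.1 trivial).symm⟩
  · constructor
    · rintro ⟨a, b, ha, hb, hab⟩
      obtain ⟨z, rfl, rfl⟩ := hL p.1 p.2 a b hab
      exact ⟨z, ha, hb⟩
    · rintro ⟨z, ha, hb⟩
      exact ⟨_, _, ha, hb, h.not_forbidden p.1 trivial z trivial p.2 trivial⟩

/-- Each of the countably many tasks `(x, y, a, b)` is met by a cofinal set of finite networks, so
by the Rasiowa–Sikorski lemma some ideal meets all of them. Its union is the network. -/
theorem exists_saturated_network [Finite S] [Finite T] (hST : Nat.card S ≤ Nat.card T) :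
    ∃ L : ℕ → ℕ → RainbowAtom S T, IsNetwork Set.univ L ∧
      ∀ x y a b, ¬ Forbidden a b (L x y) → ∃ z, L x z = a ∧ L z y = b := by
  have : Finite (RainbowAtom S T) := RainbowAtom.finite
  let _ : Encodable (ℕ × ℕ × RainbowAtom S T × RainbowAtom S T) := Encodable.ofCountable _
  let 𝒟 : ℕ × ℕ × RainbowAtom S T × RainbowAtom S T → Order.Cofinal (FiniteNetwork S T) :=
    fun q => ⟨{N | N.Realizes q.1 q.2.1 q.2.2.1 q.2.2.2}, fun N => by
      obtain ⟨M, h1, h2⟩ := N.exists_realizes hST q.1 q.2.1 q.2.2.1 q.2.2.2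
      exact ⟨M, h2, h1⟩⟩
  let N₀ : FiniteNetwork S T := ⟨∅, fun _ _ => one, by constructor <;> simp⟩
  let I := Order.idealOfCofinals N₀ 𝒟
  have hI : ∀ x y a b, ∃ N ∈ I, N.Realizes x y a b := fun x y a b => by
    obtain ⟨N, h1, h2⟩ := Order.cofinal_meets_idealOfCofinals N₀ 𝒟 (x, y, a, b)
    exact ⟨N, h2, h1⟩
  have hdir : ∀ M ∈ I, ∀ N ∈ I, ∃ K ∈ I, M ≤ K ∧ N ≤ K := I.directed
  have hex : ∀ x y, ∃ N ∈ I, x ∈ N.nodes ∧ y ∈ N.nodes := fun x y => by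
    -- The path is irrelevant; the task only serves to make `x` and `y` nodes.
    obtain ⟨N, h1, h2, h3, -⟩ := hI x y one one
    exact ⟨N, h1, h2, h3⟩
  choose N hNI hNx hNy using hex
  let L : ℕ → ℕ → RainbowAtom S T := fun x y => (N x y).label x y
  -- By directedness the label does not depend on the network chosen in the ideal.
  have hL : ∀ M ∈ I, ∀ x ∈ M.nodes, ∀ y ∈ M.nodes, L x y = M.label x y := by
    intro M hM x hx y hy
    obtain ⟨K, -, h1, h2⟩ := hdir M hM (N x y) (hNI x y)
    rw [← h1.2 x hx y hy, h2.2 x (hNx x y) y (hNy x y)]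
  refine ⟨L, ⟨fun x _ y _ => ?_, fun x _ y _ => ?_, fun x _ y _ z _ => ?_⟩, fun x y a b hab => ?_⟩
  · exact (N x y).isNetwork.eq_one_iff x (hNx x y) y (hNy x y)
  · rw [hL _ (hNI x y) y (hNy x y) x (hNx x y)]
    exact (N x y).isNetwork.conv x (hNx x y) y (hNy x y)
  · obtain ⟨K, hK, h1, h2⟩ := hdir _ (hNI x y) _ (hNI z z)
    have hx := h1.1 (hNx x y)
    have hy := h1.1 (hNy x y)
    have hz := h2.1 (hNx z z)
    rw [hL K hK x hx y hy, hL K hK y hy z hz, hL K hK x hx z hz]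
    exact K.isNetwork.not_forbidden x hx y hy z hz
  · obtain ⟨M, hM, hx, hy, h⟩ := hI x y a b
    rw [hL M hM x hx y hy] at hab
    obtain ⟨z, hz, h1, h2⟩ := h hab
    exact ⟨z, by rw [hL M hM x hx z hz, h1], by rw [hL M hM z hz y hy, h2]⟩

theorem representable_of_card_le [Finite S] [Finite T] (hST : Nat.card S ≤ Nat.card T) :
    Representable.{_, w} (RainbowAlgebra S T) := by
  obtain ⟨L, h1, h2⟩ := exists_saturated_network hST
  -- The lift moves the countable base to the arbitrary universe `w`.
  refine ⟨ULift ℕ, ⊤, IsNetwork.nonempty_representation (L := fun x y => L x.down y.down)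
    ⟨fun x _ y _ => ?_, fun x _ y _ => h1.conv _ trivial _ trivial,
      fun x _ y _ z _ => h1.not_forbidden _ trivial _ trivial _ trivial⟩ fun x y a b hab => ?_⟩
  · rw [h1.eq_one_iff _ trivial _ trivial, ULift.down_inj]
  · obtain ⟨z, hz⟩ := h2 x.down y.down a b hab
    exact ⟨⟨z⟩, hz⟩

theorem theorem3p2 (S : Type u) (T : Type v) [Finite S] [Finite T] (hS : 2 ≤ Nat.card S) :
    Representable.{max u v, w} (RainbowAlgebra S T) ↔ Nat.card S ≤ Nat.card T :=
  ⟨Representable.card_le hS, representable_of_card_le⟩
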